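/- Let $S$ be a set of $N$ points in the Euclidean plane. A \emph{plane graph} of $S$ is a simple graph with vertex set $S$ whose edges, drawn as straight line segments between their endpoints, form an embedding: no edge contains a point of $S$ other than its two endpoints, and two distinct edges can meet only at a common endpoint. Let $\mathrm{pg}(S)$ denote the number of plane graphs of $S$ (as labeled graphs, i.e. distinguished by their edge sets), and let $\mathrm{pg}(N)=\max_{|S|=N}\mathrm{pg}(S)$. \textbf{Theorem.} For every $N$, $\mathrm{pg}(N)\le 3207.42^N$; that is, every set $S$ of $N$ points in the plane has at most $3207.42^N$ plane graphs. -/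

import Mathlib

/-- The Euclidean plane. -/
abbrev Plane : Type := EuclideanSpace ℝ (Fin 2)

/-- A graph `G` whose vertex set is the point set `S`, with each edge `pq` drawn as the closed
straight segment from `p` to `q`, is a plane (crossing-free straight-edge) graph: this drawing
is an embedding. -/
structure IsPlaneGraph (S : Finset Plane) (G : SimpleGraph S) : Prop where
  /-- An edge passes through no vertex other than its two endpoints. -/
  vertex_edge : ∀ p q r : S, G.Adj p q →
    (r : Plane) ∈ segment ℝ (p : Plane) (q : Plane) → r = p ∨ r = q
  /-- Two distinct edges can meet only at a common endpoint. -/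
  edge_edge : ∀ p q r s : S, G.Adj p q → G.Adj r s → s(p, q) ≠ s(r, s) →
    ∀ x : Plane, x ∈ segment ℝ (p : Plane) (q : Plane) → x ∈ segment ℝ (r : Plane) (s : Plane) →
      (x = p ∨ x = q) ∧ (x = r ∨ x = s)

/-- The set of all plane graphs of the point set `S` (labeled: graphs on the vertex set `S`
are distinguished by their edge sets, not up to isomorphism). -/
def planeGraphs (S : Finset Plane) : Set (SimpleGraph S) :=
  {G | IsPlaneGraph S G}

/-- There are finitely many plane graphs of `S`, so counting them with `Set.ncard` is honest. -/
theorem planeGraphs_finite (S : Finset Plane) : (planeGraphs S).Finite :=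
  Set.toFinite _

/-- The number `pg(S)` of plane graphs of the point set `S`. -/
noncomputable def pg (S : Finset Plane) : ℕ :=
  (planeGraphs S).ncard

/-!
The proof gives the stronger bound `pg S ≤ 1024 ^ N`, by comparing `pg S` with the number of plane
graphs in which a given point is isolated.

Fix a point `v` and a plane graph `H` in which `v` is isolated, and let `m` be the number of points
that `v` sees in `H`. Edges from `v` never cross each other, so the plane graphs that agree with `H`
away from `v` form a cube of `2 ^ m` graphs, in which `v` has average degree `m / 2`. Exactly one of
them has `v` isolated, and `2 ^ (10 - m) ≥ 11 - m`; hence (`sum_fiber_le`) `1024` times the number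
of plane graphs with `v` isolated is at least `11 pg S - 2 ∑ deg v`, where the sum is over all plane
graphs. Summing over `v` and using that a plane graph has on average at most `5 N / 2` edges, one
gets `N pg S ≤ 1024 ∑ pg (S \ {v})` (`card_mul_pg_le`), and the bound follows by induction.

The bound on the number of edges comes from a charging scheme. Choose coordinates in which no two
points of `S` have the same abscissa. An edge `u v` with left end `u` either is topmost among the
edges from `v` to the left, and is charged to `v`; or there is a next edge `u' v` above it. Let `w`
be the rightmost point of `S` other than `v` in the triangle `v u u'`, and charge `u v` to `w`. If
`w = u`, then `u v` is the lower side of an empty region ("`u` has a roof"), and otherwise `w` sees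
`v` and `u v` is the next edge below ("a floor"). By the crossing lemma
`exists_mem_segment_of_notMem_closedTriangle`, each of the last two kinds of charge reaches a vertex
at most once, as the first one clearly does, which bounds the number of edges by `2 N` plus the number of vertices with a roof
(`IsPlaneGraph.card_rightDarts_le`). Finally, deleting the roofed edge at `w` is an injection from
the plane graphs in which `w` has a roof to those in which it has none
(`two_mul_card_hasRoof_le`), so on average at most `N / 2` vertices have a roof.
-/

/-! ### Elementary geometry of triangles and segments -/

/-- Twice the signed area of the triangle `p q r`, in the coordinates `X`, `Y`. -/
def cross (X Y : Plane →ₗ[ℝ] ℝ) (p q r : Plane) : ℝ :=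
  (X q - X p) * (Y r - Y p) - (Y q - Y p) * (X r - X p)

/-- The slope of the line `p q` in the coordinates `X`, `Y`. -/
noncomputable def slopeXY (X Y : Plane →ₗ[ℝ] ℝ) (p q : Plane) : ℝ :=
  (Y q - Y p) / (X q - X p)

/-- The closed triangle `a b c`, given by barycentric coordinates. -/
def closedTriangle (a b c : Plane) : Set Plane :=
  {p | ∃ α β γ : ℝ, 0 ≤ α ∧ 0 ≤ β ∧ 0 ≤ γ ∧ α + β + γ = 1 ∧ p = α • a + β • b + γ • c}

theorem left_mem_closedTriangle (a b c : Plane) : a ∈ closedTriangle a b c :=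
  ⟨1, 0, 0, by norm_num, le_rfl, le_rfl, by norm_num, by simp⟩

theorem middle_mem_closedTriangle (a b c : Plane) : b ∈ closedTriangle a b c :=
  ⟨0, 1, 0, le_rfl, by norm_num, le_rfl, by norm_num, by simp⟩

theorem right_mem_closedTriangle (a b c : Plane) : c ∈ closedTriangle a b c :=
  ⟨0, 0, 1, le_rfl, le_rfl, by norm_num, by norm_num, by simp⟩

theorem convex_closedTriangle (a b c : Plane) : Convex ℝ (closedTriangle a b c) := by
  rintro _ ⟨α, β, γ, hα, hβ, hγ, h, rfl⟩ _ ⟨α', β', γ', hα', hβ', hγ', h', rfl⟩ s t hs ht hst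
  refine ⟨s * α + t * α', s * β + t * β', s * γ + t * γ', by positivity, by positivity,
    by positivity, ?_, by module⟩
  linear_combination s * h + t * h' + hst

theorem closedTriangle_subset {a b c : Plane} {s : Set Plane} (hs : Convex ℝ s) (ha : a ∈ s)
    (hb : b ∈ s) (hc : c ∈ s) : closedTriangle a b c ⊆ s := by
  rintro _ ⟨α, β, γ, hα, hβ, hγ, h, rfl⟩
  have := hs.sum_mem (t := Finset.univ) (w := ![α, β, γ]) (z := ![a, b, c])
    (by intro i _; fin_cases i <;> simpa) (by simpa [Fin.sum_univ_three] using h)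
    (by intro i _; fin_cases i <;> simpa)
  simpa [Fin.sum_univ_three] using this

section
variable {X Y : Plane →ₗ[ℝ] ℝ} {p q r : Plane}

theorem map_le_of_mem_segment (hp : p ∈ segment ℝ q r) (h : X q ≤ X r) :
    X q ≤ X p ∧ X p ≤ X r := by
  obtain ⟨a, b, ha, hb, hab, rfl⟩ := hp
  obtain rfl : a = 1 - b := by linarith
  simp only [map_add, map_smul, smul_eq_mul]
  constructor <;> nlinarith

theorem map_lt_of_mem_segment (hp : p ∈ segment ℝ q r) (h : X q < X r) (hq : p ≠ q) (hr : p ≠ r) :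
    X q < X p ∧ X p < X r := by
  obtain ⟨a, b, ha, hb, hab, rfl⟩ := hp
  obtain rfl : a = 1 - b := by linarith
  have hb0 : 0 < b := lt_of_le_of_ne hb (by rintro rfl; simp at hq)
  have hb1 : 0 < 1 - b := lt_of_le_of_ne ha (by
    intro h; obtain rfl : b = 1 := by linarith
    simp at hr)
  simp only [map_add, map_smul, smul_eq_mul]
  constructor <;> nlinarith

theorem cross_pos_iff (h₁ : X p < X q) (h₂ : X r < X q) :
    0 < cross X Y p q r ↔ slopeXY X Y r q < slopeXY X Y p q := by
  have h₁' : 0 < X q - X p := sub_pos.2 h₁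
  have h₂' : 0 < X q - X r := sub_pos.2 h₂
  rw [slopeXY, slopeXY, div_lt_div_iff₀ h₂' h₁', cross, ← sub_pos (b := (Y q - Y r) * _)]
  constructor <;> intro h <;> linarith

theorem cross_neg_iff (h₁ : X p < X q) (h₂ : X r < X q) :
    cross X Y p q r < 0 ↔ slopeXY X Y p q < slopeXY X Y r q := by
  have h₁' : 0 < X q - X p := sub_pos.2 h₁
  have h₂' : 0 < X q - X r := sub_pos.2 h₂
  rw [slopeXY, slopeXY, div_lt_div_iff₀ h₁' h₂', cross, ← sub_pos (a := (Y q - Y r) * _)]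
  constructor <;> intro h <;> linarith

/-- If `q` and `r` lie on a common ray from `p`, the nearer one lies on the segment from `p` to the
farther one. -/
theorem mem_segment_of_cross_eq_zero (hXY : ∀ p q, X p = X q → Y p = Y q → p = q)
    (hq : X p < X q) (hr : X q ≤ X r) (h : cross X Y p q r = 0) : q ∈ segment ℝ p r := by
  have h' : 0 < X r - X p := by linarith
  have h'' : X r - X p ≠ 0 := h'.ne'
  have hX : X q = X (((X r - X q) / (X r - X p)) • p + ((X q - X p) / (X r - X p)) • r) := by
    simp only [map_add, map_smul, smul_eq_mul]; field_simp; ring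
  refine ⟨(X r - X q) / (X r - X p), (X q - X p) / (X r - X p), div_nonneg (by linarith) h'.le,
    div_nonneg (by linarith) h'.le, by field_simp; ring, (hXY _ _ hX ?_).symm⟩
  simp only [map_add, map_smul, smul_eq_mul, cross] at h ⊢
  field_simp
  linear_combination -h

/-- The crossing lemma: let `x`, `u` lie to the left of `v`, and let `a`, to the right of `x`, lie
on the same side of the line `x v` as `u`. If `a` is outside the triangle `x v u`, then the segment
`x a` leaves this triangle through the side `v u`. -/
theorem exists_mem_segment_of_notMem_closedTriangle
    (hXY : ∀ p q, X p = X q → Y p = Y q → p = q) {x v u a : Plane}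
    (hside : 0 < cross X Y x v u * cross X Y x v a) (hu : X u ≤ X x) (hv : X x < X v)
    (ha : X x ≤ X a) (hna : a ∉ closedTriangle x v u) :
    ∃ y, y ∈ segment ℝ x a ∧ y ∈ segment ℝ u v := by
  have hD : cross X Y x v u ≠ 0 := by rintro h; simp [h] at hside
  set γ := cross X Y x v a / cross X Y x v u with hγ
  set α := cross X Y x a u / cross X Y x v u with hα
  have hγ0 : 0 < γ := by
    rw [hγ, div_eq_mul_inv, ← mul_pos_iff_of_pos_right (sq_pos_of_ne_zero hD)]
    have : cross X Y x v a * (cross X Y x v u)⁻¹ * cross X Y x v u ^ 2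
      = cross X Y x v u * cross X Y x v a := by field_simp
    rwa [this]
  have hXa : X a = (1 - α - γ) * X x + α * X v + γ * X u := by
    rw [hα, hγ]; field_simp; simp only [cross]; ring
  have hYa : Y a = (1 - α - γ) * Y x + α * Y v + γ * Y u := by
    rw [hα, hγ]; field_simp; simp only [cross]; ring
  have haeq : a = (1 - α - γ) • x + α • v + γ • u :=
    hXY _ _ (by simpa using hXa) (by simpa using hYa)
  have hα0 : 0 ≤ α := by
    by_contra! h
    nlinarith [mul_pos_of_neg_of_neg h (sub_neg.2 hv), mul_nonneg hγ0.le (sub_nonneg.2 hu)]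
  have h1 : 1 < α + γ := by
    by_contra! h
    exact hna ⟨1 - α - γ, α, γ, by linarith, hα0, hγ0.le, by ring, haeq⟩
  have h0 : 0 < α + γ := by linarith
  refine ⟨(γ / (α + γ)) • u + (α / (α + γ)) • v, ⟨1 - 1 / (α + γ), 1 / (α + γ), ?_, by positivity,
    by ring, ?_⟩, γ / (α + γ), α / (α + γ), by positivity, by positivity, by field_simp; ring, rfl⟩
  · rw [sub_nonneg, div_le_one h0]; exact h1.le
  · apply hXY
    · simp only [map_add, map_smul, smul_eq_mul, hXa]; field_simp; ring
    · simp only [map_add, map_smul, smul_eq_mul, hYa]; field_simp; ring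

/-- If two segments starting at `v` share a point other than `v`, one of them contains the
other. -/
theorem mem_segment_or_mem_segment_of_common {x v u u' : Plane} (hx : x ∈ segment ℝ v u)
    (hx' : x ∈ segment ℝ v u') (hxv : x ≠ v) : u ∈ segment ℝ v u' ∨ u' ∈ segment ℝ v u := by
  rw [segment_eq_image'] at hx hx'
  obtain ⟨s, ⟨hs0, hs1⟩, rfl⟩ := hx
  obtain ⟨t, ⟨ht0, ht1⟩, h⟩ := hx'
  have hs : 0 < s := lt_of_le_of_ne hs0 (by rintro rfl; simp at hxv)
  have h' : t • (u' - v) = s • (u - v) := add_left_cancel h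
  have ht : 0 < t := lt_of_le_of_ne ht0 (by
    rintro rfl
    simp only [zero_smul] at h'
    exact hxv (by simp [← h']))
  rcases le_total t s with hts | hts
  · left
    rw [segment_eq_image']
    refine ⟨t / s, ⟨by positivity, (div_le_one hs).2 hts⟩, ?_⟩
    have : (t / s) • (u' - v) = u - v := by
      rw [div_eq_inv_mul, mul_smul, h', smul_smul, inv_mul_cancel₀ hs.ne', one_smul]
    simp [this]
  · right
    rw [segment_eq_image']
    refine ⟨s / t, ⟨by positivity, (div_le_one ht).2 hts⟩, ?_⟩
    have : (s / t) • (u - v) = u' - v := by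
      rw [div_eq_inv_mul, mul_smul, ← h', smul_smul, inv_mul_cancel₀ ht.ne', one_smul]
    simp [this]

end

/-- Some linear coordinate system has an abscissa that separates the points of `S`. -/
theorem exists_separating_coordinates (S : Finset Plane) : ∃ X Y : Plane →ₗ[ℝ] ℝ,
    (∀ p q, X p = X q → Y p = Y q → p = q) ∧ ∀ p ∈ S, ∀ q ∈ S, X p = X q → p = q := by
  obtain ⟨s, hs⟩ := Finset.exists_notMem
    ((S ×ˢ S).image fun pq => -(pq.1 0 - pq.2 0) / (pq.1 1 - pq.2 1))
  let e (i : Fin 2) : Plane →ₗ[ℝ] ℝ :=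
    { toFun := fun p => p i, map_add' := fun _ _ => rfl, map_smul' := fun _ _ => rfl }
  have key : ∀ p q : Plane, (e 0 + s • e 1) p = (e 0 + s • e 1) q → p 1 = q 1 → p = q := by
    intro p q h h1
    have h' : p 0 + s * p 1 = q 0 + s * q 1 := h
    ext i
    fin_cases i
    · simpa [h1] using h'
    · exact h1
  refine ⟨e 0 + s • e 1, e 1, key, fun p hp q hq h => ?_⟩
  by_cases h1 : p 1 = q 1
  · exact key p q h h1
  · refine absurd (Finset.mem_image.2 ⟨(p, q), Finset.mk_mem_product hp hq, ?_⟩) hs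
    have h' : p 0 + s * p 1 = q 0 + s * q 1 := h
    have : p 1 - q 1 ≠ 0 := sub_ne_zero.2 h1
    simp only
    field_simp
    linear_combination -h'

/-! ### Charging the edges of a plane graph to its vertices -/

/-- For `ε = 1` (`ε = -1`), the segment `u v` passes above (below) `w`, and among the points of `S` in
the triangle `w v u` only `v` lies to the right of `w`. -/
def Closes (X Y : Plane →ₗ[ℝ] ℝ) (ε : ℝ) (S : Finset Plane) (w v u : Plane) : Prop :=
  X u < X w ∧ X w < X v ∧ 0 < ε * cross X Y w v u ∧
    ∀ t ∈ S, t ∈ closedTriangle w v u → t = v ∨ X t ≤ X w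

/-- The edge `w v` of `G`, with `v` to the right of `w`, is the lower side of a triangle whose third
corner `u` lies to the left of `w` and is joined to `v`; no point of `S` in this triangle other than
`v` lies to the right of `w`. -/
def HasRoof (X Y : Plane →ₗ[ℝ] ℝ) {S : Finset Plane} (G : SimpleGraph S) (w v : S) : Prop :=
  G.Adj w v ∧ ∃ u, G.Adj u v ∧ Closes X Y 1 S w v u

/-- The segment `w v` is not crossed by an edge of `G`, the edge `u v` is the next one below it
among the edges from `v` to the left, and no point of `S` in the triangle `w v u` other than `v`
lies to the right of `w`. The segment `w v` need not be an edge. -/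
def HasFloor (X Y : Plane →ₗ[ℝ] ℝ) {S : Finset Plane} (G : SimpleGraph S) (w v u : S) : Prop :=
  G.Adj u v ∧ Closes X Y (-1) S w v u ∧
    (∀ a b, G.Adj a b → s(a, b) ≠ s(w, v) →
      ∀ y ∈ segment ℝ (w : Plane) v, y ∈ segment ℝ (a : Plane) b → y = w ∨ y = v) ∧
    ∀ u', G.Adj u' v → X u' < X v → slopeXY X Y u' v < slopeXY X Y u v →
      slopeXY X Y u' v ≤ slopeXY X Y w v

section
variable {X Y : Plane →ₗ[ℝ] ℝ} {S : Finset Plane} {G H : SimpleGraph S}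

theorem IsPlaneGraph.mono (hG : IsPlaneGraph S G) (h : H ≤ G) : IsPlaneGraph S H :=
  ⟨fun p q r hpq => hG.vertex_edge p q r (h hpq),
    fun p q r s hpq hrs => hG.edge_edge p q r s (h hpq) (h hrs)⟩

/-- A vertex `w` admits at most one closing edge on each side: if there were two, the crossing
lemma would make one of the segments from `w` cross the opposite closing edge. -/
theorem Closes.unique (hXY : ∀ p q, X p = X q → Y p = Y q → p = q) {ε : ℝ}
    {w v₁ u₁ v₂ u₂ : Plane} (h₁ : Closes X Y ε S w v₁ u₁) (h₂ : Closes X Y ε S w v₂ u₂)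
    (hv₁ : v₁ ∈ S) (hv₂ : v₂ ∈ S) (n₁ : ∀ y ∈ segment ℝ w v₂, y ∉ segment ℝ u₁ v₁)
    (n₂ : ∀ y ∈ segment ℝ w v₁, y ∉ segment ℝ u₂ v₂) : v₁ = v₂ := by
  have main : ∀ {v₁ u₁ v₂ : Plane}, Closes X Y ε S w v₁ u₁ → v₂ ∈ S → X w < X v₂ →
      (∀ y ∈ segment ℝ w v₂, y ∉ segment ℝ u₁ v₁) → 0 < ε * cross X Y w v₁ v₂ → v₁ = v₂ := by
    intro v₁ u₁ v₂ ⟨hu, hv, hc, he⟩ hv₂ hwv n hε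
    by_contra hne
    obtain ⟨y, hy, hy'⟩ := exists_mem_segment_of_notMem_closedTriangle (a := v₂) hXY
      (by
        have := mul_pos hc hε
        have h2 : 0 < ε ^ 2 * (cross X Y w v₁ u₁ * cross X Y w v₁ v₂) := by linarith
        exact pos_of_mul_pos_right h2 (sq_nonneg _))
      hu.le hv hwv.le
      (fun ht => (he _ hv₂ ht).elim (fun h => hne h.symm) fun h => h.not_gt hwv)
    exact n y hy hy'
  have hanti : cross X Y w v₂ v₁ = -cross X Y w v₁ v₂ := by simp only [cross]; ring
  rcases lt_trichotomy (ε * cross X Y w v₁ v₂) 0 with h | h | h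
  · exact (main h₂ hv₁ h₁.2.1 n₂ (by rw [hanti]; linarith)).symm
  · have h0 : cross X Y w v₁ v₂ = 0 := by
      rcases mul_eq_zero.1 h with h | h
      · simpa [h] using h₁.2.2.1
      · exact h
    rcases le_total (X v₁) (X v₂) with hle | hle
    · exact absurd (right_mem_segment ℝ _ _)
        (n₁ _ (mem_segment_of_cross_eq_zero hXY h₁.2.1 hle h0))
    · exact absurd (right_mem_segment ℝ _ _)
        (n₂ _ (mem_segment_of_cross_eq_zero hXY h₂.2.1 hle (by rw [hanti, h0, neg_zero])))
  · exact main h₁ hv₂ h₂.2.1 n₁ h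

theorem IsPlaneGraph.notMem_segment (hG : IsPlaneGraph S G) {w v₁ u₁ v₂ : S}
    (h₂ : G.Adj w v₂) (h₁ : G.Adj u₁ v₁) (hu : X u₁ < X w) (hv₁ : X w < X v₁) (hv₂ : X w < X v₂)
    (hne : v₁ ≠ v₂) : ∀ y ∈ segment ℝ (w : Plane) v₂, y ∉ segment ℝ (u₁ : Plane) v₁ := by
  intro y hy hy'
  have hwu : w ≠ u₁ := by rintro rfl; exact hu.ne rfl
  have hwv : w ≠ v₁ := by rintro rfl; exact hv₁.ne rfl
  have hvu : v₂ ≠ u₁ := by rintro rfl; exact (hu.trans hv₂).ne rfl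
  have := hG.edge_edge _ _ _ _ h₂ h₁ (by simp [hwu, hwv]) y hy hy'
  rcases this with ⟨rfl | rfl, h | h⟩
  · exact hwu (Subtype.ext h)
  · exact hwv (Subtype.ext h)
  · exact hvu (Subtype.ext h)
  · exact hne (Subtype.ext h).symm

theorem HasRoof.unique (hXY : ∀ p q, X p = X q → Y p = Y q → p = q) (hG : IsPlaneGraph S G)
    {w v₁ v₂ : S} (h₁ : HasRoof X Y G w v₁) (h₂ : HasRoof X Y G w v₂) : v₁ = v₂ := by
  obtain ⟨a₁, u₁, b₁, c₁⟩ := h₁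
  obtain ⟨a₂, u₂, b₂, c₂⟩ := h₂
  by_contra hne
  exact hne (Subtype.ext (c₁.unique hXY c₂ v₁.2 v₂.2
    (hG.notMem_segment a₂ b₁ c₁.1 c₁.2.1 c₂.2.1 hne)
    (hG.notMem_segment a₁ b₂ c₂.1 c₂.2.1 c₁.2.1 (Ne.symm hne))))

/-- Two left neighbours of a vertex of a plane graph are distinguished by the slopes. -/
theorem IsPlaneGraph.eq_of_slope_eq (hXY : ∀ p q, X p = X q → Y p = Y q → p = q)
    (hG : IsPlaneGraph S G) {u₁ u₂ v : S} (h₁ : G.Adj u₁ v) (h₂ : G.Adj u₂ v) (l₁ : X u₁ < X v)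
    (l₂ : X u₂ < X v) (h : slopeXY X Y u₁ v = slopeXY X Y u₂ v) : u₁ = u₂ := by
  have main : ∀ {u₁ u₂ : S}, G.Adj u₁ v → G.Adj u₂ v → X u₁ < X v → X u₂ < X v →
      slopeXY X Y u₁ v = slopeXY X Y u₂ v → X u₁ ≤ X u₂ → u₁ = u₂ := by
    intro u₁ u₂ h₁ h₂ l₁ l₂ h hle
    have hc : cross X Y u₁ v u₂ = 0 := by
      have h3 := (cross_pos_iff (Y := Y) l₁ l₂).not.2 h.symm.not_lt
      have h4 := (cross_neg_iff (Y := Y) l₁ l₂).not.2 h.not_lt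
      exact le_antisymm (not_lt.1 h3) (not_lt.1 h4)
    rcases hle.eq_or_lt with heq | hlt
    · refine Subtype.ext (hXY _ _ heq ?_)
      simp only [slopeXY, heq] at h
      have : X v - X u₂ ≠ 0 := (sub_pos.2 l₂).ne'
      field_simp at h
      linarith
    · have hm : (u₂ : Plane) ∈ segment ℝ (u₁ : Plane) v :=
        mem_segment_of_cross_eq_zero hXY hlt l₂.le
          (show cross X Y u₁ u₂ v = 0 by simp only [cross] at hc ⊢; linarith)
      rcases hG.vertex_edge _ _ _ h₁ hm with h | h
      · exact h.symm
      · exact absurd h₂ (by rw [h]; exact G.loopless.irrefl _)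
  rcases le_total (X u₁) (X u₂) with hle | hle
  · exact main h₁ h₂ l₁ l₂ h hle
  · exact (main h₂ h₁ l₂ l₁ h.symm hle).symm

theorem HasFloor.unique (hXY : ∀ p q, X p = X q → Y p = Y q → p = q) (hG : IsPlaneGraph S G)
    {w v₁ v₂ u₁ u₂ : S} (h₁ : HasFloor X Y G w v₁ u₁) (h₂ : HasFloor X Y G w v₂ u₂) :
    v₁ = v₂ ∧ u₁ = u₂ := by
  have main : ∀ {v₁ v₂ u₁ u₂ : S}, HasFloor X Y G w v₁ u₁ → HasFloor X Y G w v₂ u₂ → v₁ ≠ v₂ →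
      ∀ y ∈ segment ℝ (w : Plane) v₂, y ∉ segment ℝ (u₁ : Plane) v₁ := by
    intro v₁ v₂ u₁ u₂ ⟨b₁, c₁, _, _⟩ ⟨_, c₂, d₂, _⟩ hne y hy hy'
    have hwu : w ≠ u₁ := by rintro rfl; exact c₁.1.ne rfl
    have hwv : w ≠ v₁ := by rintro rfl; exact c₁.2.1.ne rfl
    have hvu : v₂ ≠ u₁ := by rintro rfl; exact (c₁.1.trans c₂.2.1).ne rfl
    rcases d₂ _ _ b₁ (by simp [hwu.symm, hwv.symm]) y hy hy' with rfl | rfl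
    · exact (hG.vertex_edge _ _ _ b₁ hy').elim hwu hwv
    · exact (hG.vertex_edge _ _ _ b₁ hy').elim hvu hne.symm
  obtain rfl : v₁ = v₂ := by
    by_contra hne
    exact hne (Subtype.ext (h₁.2.1.unique hXY h₂.2.1 v₁.2 v₂.2 (main h₁ h₂ hne)
      (main h₂ h₁ (Ne.symm hne))))
  obtain ⟨b₁, ⟨l₁, m, c₁, _⟩, _, e₁⟩ := h₁
  obtain ⟨b₂, ⟨l₂, _, c₂, _⟩, _, e₂⟩ := h₂
  have s₁ := (cross_neg_iff m (l₁.trans m)).1 (by linarith)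
  have s₂ := (cross_neg_iff m (l₂.trans m)).1 (by linarith)
  refine ⟨rfl, hG.eq_of_slope_eq hXY b₁ b₂ (l₁.trans m) (l₂.trans m) ?_⟩
  rcases lt_trichotomy (slopeXY X Y u₁ v₁) (slopeXY X Y u₂ v₁) with h | h | h
  · exact absurd (e₂ _ b₁ (l₁.trans m) h) s₁.not_ge
  · exact h
  · exact absurd (e₁ _ b₂ (l₂.trans m) h) s₂.not_ge

/-- No edge from `v` to the left runs above `u v`; for edges that end at `v`, higher means a smaller
slope. -/
def IsTopLeft (X Y : Plane →ₗ[ℝ] ℝ) (G : SimpleGraph S) (u v : S) : Prop :=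
  ∀ u', G.Adj u' v → X u' < X v → slopeXY X Y u v ≤ slopeXY X Y u' v

/-- The region between two consecutive edges `u v`, `u' v` from `v` to the left: the rightmost point
`w ≠ v` of `S` in the triangle `v u u'` sees `v`. An edge crossing `w v` would have its right end
outside the triangle, and would leave the triangle through `u v` or `u' v`. -/
theorem IsPlaneGraph.not_crossed_of_rightmost (hXY : ∀ p q, X p = X q → Y p = Y q → p = q)
    (hS : ∀ p ∈ S, ∀ q ∈ S, X p = X q → p = q) (hG : IsPlaneGraph S G) {u u' v w : S}
    (hu : G.Adj u v) (hu' : G.Adj u' v) (lu : X u < X v) (lu' : X u' < X v)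
    (hw : (w : Plane) ∈ closedTriangle (v : Plane) u u') (hwv : X w < X v)
    (hmax : ∀ t ∈ S, t ∈ closedTriangle (v : Plane) u u' → t = v ∨ X t ≤ X w)
    (hsu : slopeXY X Y w v < slopeXY X Y u v) (hsu' : slopeXY X Y u' v < slopeXY X Y w v)
    (hnext : ∀ u'', G.Adj u'' v → X u'' < X v → slopeXY X Y u'' v < slopeXY X Y u v →
      slopeXY X Y u'' v ≤ slopeXY X Y u' v)
    {a b : S} (hab : G.Adj a b) {x : Plane} (hx : x ∈ segment ℝ (w : Plane) v)
    (hxab : x ∈ segment ℝ (a : Plane) b) : x = w ∨ x = v := by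
  by_contra! hne
  -- orient the edge so that `a` is its right end
  wlog hba : X b < X a generalizing a b
  · have hne' : X a ≠ X b := fun h => hab.ne (Subtype.ext (hS _ a.2 _ b.2 h))
    exact this hab.symm (segment_symm ℝ (a : Plane) b ▸ hxab)
      (lt_of_le_of_ne (not_lt.1 hba) hne')
  obtain ⟨hwx, hxv⟩ := map_lt_of_mem_segment hx hwv hne.1 hne.2
  obtain ⟨hbx, hxa⟩ := map_le_of_mem_segment (segment_symm ℝ (a : Plane) b ▸ hxab) hba.le
  have hvT := left_mem_closedTriangle (v : Plane) u u'
  have huT := middle_mem_closedTriangle (v : Plane) u u'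
  have huT' := right_mem_closedTriangle (v : Plane) u u'
  have hxT := (convex_closedTriangle (v : Plane) u u').segment_subset hw hvT hx
  -- the point `x` is on the ray from `v` to `w`, hence lies strictly between the two edges
  have hslope : slopeXY X Y x v = slopeXY X Y w v := by
    obtain ⟨c, d, hc, hd, hcd, rfl⟩ := hx
    obtain rfl : d = 1 - c := by linarith
    have hc0 : c ≠ 0 := by rintro rfl; simp at hne
    have : X v - X w ≠ 0 := (sub_pos.2 hwv).ne'
    have h2 : X v - (c * X w + (1 - c) * X v) ≠ 0 := by
      have : X v - (c * X w + (1 - c) * X v) = c * (X v - X w) := by ring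
      rw [this]; positivity
    simp only [slopeXY, map_add, map_smul, smul_eq_mul]
    field_simp
    ring
  have hav : a ≠ v := by
    rintro rfl
    have hs : slopeXY X Y b a = slopeXY X Y x a := by
      have h0 : cross X Y b a x = 0 := by
        obtain ⟨c, d, hc, hd, hcd, rfl⟩ := hxab
        obtain rfl : d = 1 - c := by linarith
        simp only [cross, map_add, map_smul, smul_eq_mul]
        ring
      have h3 := (cross_pos_iff (Y := Y) hba hxv).not.1 h0.symm.not_lt
      have h4 := (cross_neg_iff (Y := Y) hba hxv).not.1 h0.not_lt
      exact le_antisymm (not_lt.1 h3) (not_lt.1 h4)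
    rw [hslope] at hs
    exact (hnext b hab.symm hba (hs ▸ hsu)).not_gt (hs ▸ hsu')
  have haT : (a : Plane) ∉ closedTriangle (v : Plane) u u' := fun h =>
    (hmax _ a.2 h).elim (fun h => hav (Subtype.ext h)) fun h => by linarith
  have hxa_sub : segment ℝ x (a : Plane) ⊆ segment ℝ (a : Plane) b :=
    (convex_segment _ _).segment_subset hxab (left_mem_segment ℝ _ _)
  -- if `a` lay on the side of an edge `z v`, then `a b` would cross this edge
  have side : ∀ z : S, G.Adj z v → (z : Plane) ∈ closedTriangle (v : Plane) u u' → X z < X v →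
      ¬ 0 < cross X Y x v z * cross X Y x v a := by
    intro z hz hzT hzv hside
    have hzw : X z ≤ X w := (hmax _ z.2 hzT).resolve_left fun h => hzv.ne (by rw [h])
    have hsub : closedTriangle x v z ⊆ closedTriangle (v : Plane) u u' :=
      closedTriangle_subset (convex_closedTriangle _ _ _) hxT hvT hzT
    obtain ⟨y, hy, hy'⟩ := exists_mem_segment_of_notMem_closedTriangle (a := a) hXY hside
      (by linarith) hxv hxa (fun h => haT (hsub h))
    have hxy := (map_le_of_mem_segment hy hxa).1
    have haz : a ≠ z := by rintro rfl; linarith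
    have := hG.edge_edge _ _ _ _ hab hz (by simp [haz, hav]) y (hxa_sub hy) hy'
    rcases this with ⟨h, rfl | rfl⟩
    · linarith
    · rcases h with h | h
      · exact hav (Subtype.ext h).symm
      · rw [h] at hxv; linarith
  have hcu : cross X Y x v u < 0 := (cross_neg_iff hxv lu).2 (hslope ▸ hsu)
  have hcu' : 0 < cross X Y x v u' := (cross_pos_iff hxv lu').2 (hslope ▸ hsu')
  have h0 : cross X Y x v a = 0 := by
    rcases lt_trichotomy (cross X Y x v a) 0 with h | h | h
    · exact absurd (mul_pos_of_neg_of_neg hcu h) (side u hu huT lu)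
    · exact h
    · exact absurd (mul_pos hcu' h) (side u' hu' huT' lu')
  rcases le_or_gt (X v) (X a) with hva | hva
  · have hm := hxa_sub (mem_segment_of_cross_eq_zero hXY hxv hva h0)
    rcases hG.vertex_edge _ _ _ hab hm with h | h
    · exact hav h.symm
    · rw [h] at hxv; linarith
  · refine haT ((convex_closedTriangle _ _ _).segment_subset hxT hvT ?_)
    rcases hxa.eq_or_lt with heq | hlt
    · have hY : Y x = Y a := by
        have h1 : (X v - X x) * (Y a - Y x) = 0 := by
          simp only [cross, ← heq] at h0; linarith
        have := (mul_eq_zero.1 h1).resolve_left (sub_pos.2 hxv).ne'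
        linarith
      rw [← hXY _ _ heq hY]
      exact left_mem_segment ℝ _ _
    · exact mem_segment_of_cross_eq_zero hXY hlt hva.le
        (show cross X Y x a v = 0 by simp only [cross] at h0 ⊢; linarith)

/-- Let the edge `u v` not be topmost at its right end `v`, and let `u' v` be the next edge above
it. The rightmost point `w ≠ v` of `S` in the triangle `v u u'` is either `u`, which then has a
roof, or a point that has `u v` as a floor. -/
theorem IsPlaneGraph.hasRoof_or_hasFloor (hXY : ∀ p q, X p = X q → Y p = Y q → p = q)
    (hS : ∀ p ∈ S, ∀ q ∈ S, X p = X q → p = q) (hG : IsPlaneGraph S G) {u v : S}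
    (hu : G.Adj u v) (lu : X u < X v) (hnt : ¬ IsTopLeft X Y G u v) :
    HasRoof X Y G u v ∨ ∃ w, HasFloor X Y G w v u := by
  classical
  obtain ⟨u', hu'm, hnext⟩ := Finset.exists_max_image
    (Finset.univ.filter fun u' : S => G.Adj u' v ∧ X u' < X v ∧
      slopeXY X Y u' v < slopeXY X Y u v) (fun u' => slopeXY X Y u' v) (by
        simp only [IsTopLeft, not_forall, not_le] at hnt
        obtain ⟨u', h1, h2, h3⟩ := hnt
        exact ⟨u', by simp [h1, h2, h3]⟩)
  simp only [Finset.mem_filter, Finset.mem_univ, true_and] at hu'm hnext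
  obtain ⟨hu', lu', su'⟩ := hu'm
  have hvT := left_mem_closedTriangle (v : Plane) u u'
  have huT := middle_mem_closedTriangle (v : Plane) u u'
  have huT' := right_mem_closedTriangle (v : Plane) u u'
  have huv : (u : Plane) ≠ v := fun h => lu.ne (by rw [h])
  have huv' : (u' : Plane) ≠ v := fun h => lu'.ne (by rw [h])
  have huu' : (u' : Plane) ≠ u := fun h => su'.ne (by rw [h])
  obtain ⟨w, hwm, hmax⟩ := Finset.exists_max_image
    (S.filter fun t => t ∈ closedTriangle (v : Plane) u u' ∧ t ≠ v) (fun t => X t)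
    ⟨u, by simp [huT, huv]⟩
  simp only [Finset.mem_filter] at hwm hmax
  obtain ⟨hwS, hwT, hwv⟩ := hwm
  lift w to S using hwS
  replace hmax : ∀ t ∈ S, t ∈ closedTriangle (v : Plane) u u' → t = v ∨ X t ≤ X w := by
    intro t ht htT
    by_cases h : t = v
    · exact Or.inl h
    · exact Or.inr (hmax t ⟨ht, htT, h⟩)
  have hcu : 0 < cross X Y u v u' := (cross_pos_iff lu lu').2 su'
  by_cases hwu : w = u
  · left
    subst hwu
    refine ⟨hu, u', hu', lt_of_le_of_ne ((hmax _ u'.2 huT').resolve_left huv')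
      (fun h => huu' (hS _ u'.2 _ w.2 h)), lu, by linarith, fun t ht htT => hmax t ht ?_⟩
    exact closedTriangle_subset (convex_closedTriangle _ _ _) huT hvT huT' htT
  right
  have hxw : X u < X w := lt_of_le_of_ne ((hmax _ u.2 huT).resolve_left huv)
    (fun h => hwu (Subtype.ext (hS _ u.2 _ w.2 h).symm))
  obtain ⟨α, β, γ, hα, hβ, hγ, h1, hwe⟩ := hwT
  have hγ0 : 0 < γ := by
    refine lt_of_le_of_ne hγ ?_
    rintro rfl
    have : (w : Plane) ∈ segment ℝ (u : Plane) v :=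
      ⟨β, α, hβ, hα, by linarith, by rw [hwe]; module⟩
    rcases hG.vertex_edge _ _ _ hu this with h | h
    · exact hwu h
    · exact hwv (by rw [h])
  obtain rfl : α = 1 - β - γ := by linarith
  have hwvX : X w < X v := by
    rw [hwe]
    simp only [map_add, map_smul, smul_eq_mul]
    nlinarith [mul_nonneg hβ (sub_pos.2 lu).le, mul_pos hγ0 (sub_pos.2 lu')]
  have hcw : cross X Y w v u = -(γ * cross X Y u v u') := by
    rw [hwe]
    simp only [cross, map_add, map_smul, smul_eq_mul]
    ring
  have hcw' : cross X Y w v u' = β * cross X Y u v u' := by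
    rw [hwe]
    simp only [cross, map_add, map_smul, smul_eq_mul]
    ring
  have hcneg : cross X Y w v u < 0 := by rw [hcw]; linarith [mul_pos hγ0 hcu]
  have hsw : slopeXY X Y w v < slopeXY X Y u v := (cross_neg_iff hwvX lu).1 hcneg
  have hsw' : slopeXY X Y u' v ≤ slopeXY X Y w v := by
    by_contra! h
    have := (cross_neg_iff hwvX lu').2 h
    rw [hcw'] at this
    exact this.not_ge (mul_nonneg hβ hcu.le)
  have hwT : (w : Plane) ∈ closedTriangle (v : Plane) u u' :=
    ⟨_, β, γ, hα, hβ, hγ, h1, hwe⟩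
  refine ⟨w, hu, ⟨hxw, hwvX, by linarith, fun t ht htT => hmax t ht
    (closedTriangle_subset (convex_closedTriangle _ _ _) hwT hvT huT htT)⟩, ?_,
    fun u'' h h' h'' => (hnext u'' ⟨h, h', h''⟩).trans hsw'⟩
  intro a b hab hne y hy hy'
  by_cases hwu' : w = u'
  · subst hwu'
    exact (hG.edge_edge _ _ _ _ hab hu' hne y hy' hy).2
  · have hβ0 : 0 < β := by
      refine lt_of_le_of_ne hβ ?_
      rintro rfl
      have : (w : Plane) ∈ segment ℝ (u' : Plane) v :=
        ⟨γ, _, hγ, hα, by linarith, by rw [hwe]; module⟩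
      rcases hG.vertex_edge _ _ _ hu' this with h | h
      · exact hwu' h
      · exact hwv (by rw [h])
    refine hG.not_crossed_of_rightmost hXY hS hu hu' lu lu' hwT hwvX hmax hsw ?_
      (fun u'' h h' h'' => hnext u'' ⟨h, h', h''⟩) hab hy hy'
    exact (cross_pos_iff hwvX lu').1 (by rw [hcw']; exact mul_pos hβ0 hcu)

open scoped Classical in
/-- The edges of `G`, each oriented from its left to its right end. -/
noncomputable def rightDarts (X : Plane →ₗ[ℝ] ℝ) (G : SimpleGraph S) : Finset (S × S) :=
  Finset.univ.filter fun d => G.Adj d.1 d.2 ∧ X d.1 < X d.2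

open scoped Classical in
/-- An edge that is topmost at its right end is charged to that end, an edge with a roof to its left
end, and any other edge to a vertex for which it is a floor. -/
theorem IsPlaneGraph.card_rightDarts_le (hXY : ∀ p q, X p = X q → Y p = Y q → p = q)
    (hS : ∀ p ∈ S, ∀ q ∈ S, X p = X q → p = q) (hG : IsPlaneGraph S G) :
    (rightDarts X G).card ≤
      2 * S.card + (Finset.univ.filter fun w : S => ∃ v, HasRoof X Y G w v).card := by
  set D := rightDarts X G
  have hD : ∀ d ∈ D, G.Adj d.1 d.2 ∧ X d.1 < X d.2 := fun d hd => by
    simpa [D, rightDarts] using hd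
  have h1 : (D.filter fun d => IsTopLeft X Y G d.1 d.2).card ≤ S.card := by
    rw [← Fintype.card_coe S, ← Finset.card_univ]
    refine Finset.card_le_card_of_injOn Prod.snd (fun _ _ => by simp) ?_
    rintro ⟨u₁, v⟩ h₁ ⟨u₂, v'⟩ h₂ (rfl : v = v')
    rw [Finset.mem_coe, Finset.mem_filter] at h₁ h₂
    obtain ⟨a₁, l₁⟩ := hD _ h₁.1
    obtain ⟨a₂, l₂⟩ := hD _ h₂.1
    have := hG.eq_of_slope_eq hXY a₁ a₂ l₁ l₂ (le_antisymm (h₁.2 _ a₂ l₂) (h₂.2 _ a₁ l₁))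
    simpa using this
  have h2 : (D.filter fun d => HasRoof X Y G d.1 d.2).card ≤
      (Finset.univ.filter fun w : S => ∃ v, HasRoof X Y G w v).card := by
    refine Finset.card_le_card_of_injOn Prod.fst
      (fun d hd => Finset.mem_filter.2
      ⟨Finset.mem_univ _, d.2, (Finset.mem_filter.1 hd).2⟩) ?_
    rintro ⟨w, v₁⟩ h₁ ⟨w', v₂⟩ h₂ (rfl : w = w')
    rw [Finset.mem_coe, Finset.mem_filter] at h₁ h₂
    simpa using h₁.2.unique hXY hG h₂.2
  have h3 : (D.filter fun d => ∃ w, HasFloor X Y G w d.2 d.1).card ≤ S.card := by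
    rw [← Fintype.card_coe S, ← Finset.card_univ]
    refine Finset.card_le_card_of_forall_subsingleton (fun d w => HasFloor X Y G w d.2 d.1)
      (fun d hd => ?_) ?_
    · obtain ⟨w, hw⟩ := (Finset.mem_filter.1 hd).2
      exact ⟨w, Finset.mem_univ _, hw⟩
    · rintro w - ⟨u₁, v₁⟩ ⟨_, h₁⟩ ⟨u₂, v₂⟩ ⟨_, h₂⟩
      obtain ⟨hv, hu⟩ := h₁.unique hXY hG h₂
      exact Prod.ext hu hv
  have hsub : D ⊆ (D.filter fun d => IsTopLeft X Y G d.1 d.2) ∪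
      ((D.filter fun d => HasRoof X Y G d.1 d.2) ∪
        D.filter fun d => ∃ w, HasFloor X Y G w d.2 d.1) := by
    intro d hd
    obtain ⟨a, l⟩ := hD d hd
    by_cases ht : IsTopLeft X Y G d.1 d.2
    · exact Finset.mem_union_left _ (Finset.mem_filter.2 ⟨hd, ht⟩)
    · rcases hG.hasRoof_or_hasFloor hXY hS a l ht with h | h
      · exact Finset.mem_union_right _ (Finset.mem_union_left _ (Finset.mem_filter.2 ⟨hd, h⟩))
      · exact Finset.mem_union_right _ (Finset.mem_union_right _ (Finset.mem_filter.2 ⟨hd, h⟩))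
  have := Finset.card_le_card hsub
  have := Finset.card_union_le (D.filter fun d => IsTopLeft X Y G d.1 d.2)
    ((D.filter fun d => HasRoof X Y G d.1 d.2) ∪
        D.filter fun d => ∃ w, HasFloor X Y G w d.2 d.1)
  have := Finset.card_union_le (D.filter fun d => HasRoof X Y G d.1 d.2)
    (D.filter fun d => ∃ w, HasFloor X Y G w d.2 d.1)
  omega

end

/-! ### The average number of edges of a plane graph -/

section
open scoped Classical
variable {X Y : Plane →ₗ[ℝ] ℝ} {S : Finset Plane} {G H : SimpleGraph S}

/-- The plane graphs of `S`, as a finset. -/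
noncomputable def planeFinset (S : Finset Plane) : Finset (SimpleGraph S) :=
  Finset.univ.filter fun G => IsPlaneGraph S G

theorem mem_planeFinset : G ∈ planeFinset S ↔ IsPlaneGraph S G := by
  simp [planeFinset]

theorem pg_eq_card_planeFinset (S : Finset Plane) : pg S = (planeFinset S).card := by
  rw [pg, ← Set.ncard_coe_finset]
  congr 1
  ext G
  simp [planeGraphs, mem_planeFinset]

/-- At most half of the plane graphs have a roof at `w`: deleting the roofed edge leaves a graph
without a roof at `w`, from which the deleted edge can be recovered. -/
theorem two_mul_card_hasRoof_le (hXY : ∀ p q, X p = X q → Y p = Y q → p = q) (w : S) :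
    2 * ((planeFinset S).filter fun G => ∃ v, HasRoof X Y G w v).card ≤ (planeFinset S).card := by
  have hex : ∀ G : SimpleGraph S, ∃ v, (∃ v, HasRoof X Y G w v) → HasRoof X Y G w v := fun G =>
    if h : ∃ v, HasRoof X Y G w v then ⟨h.choose, fun _ => h.choose_spec⟩
    else ⟨w, fun h' => absurd h' h⟩
  choose v hv using hex
  -- the edge `u₁ v₁` that closes the roof over `w v₁` survives in `G₂`, so it does not meet `w v₂`
  have key : ∀ {G₁ G₂ : SimpleGraph S} {v₁ v₂ : S}, IsPlaneGraph S G₂ → HasRoof X Y G₁ w v₁ →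
      G₁.deleteEdges {s(w, v₁)} ≤ G₂ → G₂.Adj w v₂ → X w < X v₂ → v₁ ≠ v₂ →
      ∃ u₁ : S, Closes X Y 1 S w v₁ u₁ ∧
        ∀ y ∈ segment ℝ (w : Plane) v₂, y ∉ segment ℝ (u₁ : Plane) v₁ := by
    rintro G₁ G₂ v₁ v₂ hG₂ ⟨a₁, u₁, b₁, c₁⟩ hle a₂ hwv hne
    refine ⟨u₁, c₁, hG₂.notMem_segment a₂ (hle ?_) c₁.1 c₁.2.1 hwv hne⟩
    have h₁ : w ≠ u₁ := by rintro rfl; exact c₁.1.ne rfl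
    have h₂ : w ≠ v₁ := a₁.ne
    simp [SimpleGraph.deleteEdges_adj, b₁, h₁.symm, h₂.symm]
  have key' : ∀ {G₁ G₂ : SimpleGraph S} {v₁ v₂ : S}, IsPlaneGraph S G₁ → IsPlaneGraph S G₂ →
      HasRoof X Y G₁ w v₁ → HasRoof X Y G₂ w v₂ → G₁.deleteEdges {s(w, v₁)} ≤ G₂ →
      G₂.deleteEdges {s(w, v₂)} ≤ G₁ → v₁ = v₂ := by
    intro G₁ G₂ v₁ v₂ hG₁ hG₂ h₁ h₂ l₁ l₂
    by_contra hne
    obtain ⟨u₁, c₁, n₁⟩ := key hG₂ h₁ l₁ h₂.1 h₂.2.choose_spec.2.2.1 hne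
    obtain ⟨u₂, c₂, n₂⟩ := key hG₁ h₂ l₂ h₁.1 h₁.2.choose_spec.2.2.1 (Ne.symm hne)
    exact hne (Subtype.ext (c₁.unique hXY c₂ v₁.2 v₂.2 n₁ n₂))
  have hle : ((planeFinset S).filter fun G => ∃ v, HasRoof X Y G w v).card ≤
      ((planeFinset S).filter fun G => ¬ ∃ v, HasRoof X Y G w v).card := by
    refine Finset.card_le_card_of_injOn (fun G => G.deleteEdges {s(w, v G)}) ?_ ?_
    · intro G hG
      obtain ⟨hG, hr⟩ := Finset.mem_filter.1 hG
      rw [mem_planeFinset] at hG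
      have hd := SimpleGraph.deleteEdges_le (G := G) {s(w, v G)}
      refine Finset.mem_filter.2 ⟨mem_planeFinset.2 (hG.mono hd), ?_⟩
      rintro ⟨v', h'⟩
      have hr' : HasRoof X Y G w v' := by
        obtain ⟨a, u, b, c⟩ := h'
        exact ⟨hd a, u, hd b, c⟩
      have := hr'.unique hXY hG (hv G hr)
      subst this
      simpa using h'.1
    · intro G₁ h₁ G₂ h₂ (h : G₁.deleteEdges _ = G₂.deleteEdges _)
      obtain ⟨p₁, r₁⟩ := Finset.mem_filter.1 (Finset.mem_coe.1 h₁)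
      obtain ⟨p₂, r₂⟩ := Finset.mem_filter.1 (Finset.mem_coe.1 h₂)
      rw [mem_planeFinset] at p₁ p₂
      have e := key' p₁ p₂ (hv _ r₁) (hv _ r₂) (h.le.trans (SimpleGraph.deleteEdges_le _))
        (h.ge.trans (SimpleGraph.deleteEdges_le _))
      have a₁ := (hv _ r₁).1
      have a₂ := (hv _ r₂).1
      rw [e] at h a₁
      ext a b
      by_cases hab : s(a, b) = s(w, v G₂)
      · rw [← SimpleGraph.mem_edgeSet, ← SimpleGraph.mem_edgeSet, hab, SimpleGraph.mem_edgeSet,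
          SimpleGraph.mem_edgeSet]
        exact iff_of_true a₁ a₂
      · have := congrArg (fun K : SimpleGraph S => K.Adj a b) h
        simpa only [SimpleGraph.deleteEdges_adj, Set.mem_singleton_iff, hab, not_false_eq_true,
          and_true, eq_iff_iff] using this
  have := Finset.card_filter_add_card_filter_not (s := planeFinset S)
    (fun G => ∃ v, HasRoof X Y G w v)
  omega

/-- The neighbours of `v` in `G`. -/
noncomputable def nbrs (G : SimpleGraph S) (v : S) : Finset S :=
  Finset.univ.filter fun u => G.Adj v u

theorem mem_nbrs {u v : S} : u ∈ nbrs G v ↔ G.Adj v u := by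
  simp [nbrs]

theorem sum_card_nbrs (hS : ∀ p ∈ S, ∀ q ∈ S, X p = X q → p = q) (G : SimpleGraph S) :
    ∑ v, (nbrs G v).card = 2 * (rightDarts X G).card := by
  have h1 : ∑ v, (nbrs G v).card
      = (Finset.univ.filter fun d : S × S => G.Adj d.1 d.2).card := by
    rw [← Finset.univ_product_univ, Finset.card_filter, Finset.sum_product]
    simp only [nbrs, Finset.card_filter]
  have h2 := Finset.card_filter_add_card_filter_not
    (s := Finset.univ.filter fun d : S × S => G.Adj d.1 d.2) (fun d => X d.1 < X d.2)
  rw [Finset.filter_filter, Finset.filter_filter] at h2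
  have h3 : (Finset.univ.filter fun d : S × S => G.Adj d.1 d.2 ∧ ¬ X d.1 < X d.2).card
      = (rightDarts X G).card := by
    refine Finset.card_nbij' Prod.swap Prod.swap ?_ ?_ (fun _ _ => rfl) (fun _ _ => rfl)
    · rintro ⟨a, b⟩ h
      simp only [Finset.mem_coe, Finset.mem_filter, Finset.mem_univ, true_and, rightDarts,
        Prod.swap] at h ⊢
      refine ⟨h.1.symm, lt_of_le_of_ne (not_lt.1 h.2) fun h' => ?_⟩
      exact h.1.ne (Subtype.ext (hS _ b.2 _ a.2 h').symm)
    · rintro ⟨a, b⟩ h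
      simp only [Finset.mem_coe, Finset.mem_filter, Finset.mem_univ, true_and, rightDarts,
        Prod.swap] at h ⊢
      exact ⟨h.1.symm, h.2.le.not_gt⟩
  rw [h1, ← h2, h3, rightDarts]
  omega

/-- The average number of edges of a plane graph of `N` points is at most `5 N / 2`. -/
theorem sum_sum_card_nbrs_le (S : Finset Plane) :
    ∑ G ∈ planeFinset S, ∑ v, (nbrs G v).card ≤ 5 * S.card * (planeFinset S).card := by
  obtain ⟨X, Y, hXY, hS⟩ := exists_separating_coordinates S
  have hroof : 2 * ∑ G ∈ planeFinset S, (Finset.univ.filter fun w : S =>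
      ∃ v, HasRoof X Y G w v).card ≤ S.card * (planeFinset S).card := by
    simp only [Finset.card_filter]
    rw [Finset.sum_comm, Finset.mul_sum]
    refine (Finset.sum_le_card_nsmul _ _ (planeFinset S).card fun w _ => ?_).trans (by simp)
    rw [← Finset.card_filter]
    exact two_mul_card_hasRoof_le hXY w
  have h : ∑ G ∈ planeFinset S, ∑ v, (nbrs G v).card ≤ ∑ G ∈ planeFinset S, 2 * (2 * S.card +
      (Finset.univ.filter fun w : S => ∃ v, HasRoof X Y G w v).card) := by
    refine Finset.sum_le_sum fun G hG => ?_
    rw [sum_card_nbrs hS]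
    exact Nat.mul_le_mul_left 2 ((mem_planeFinset.1 hG).card_rightDarts_le hXY hS)
  rw [← Finset.mul_sum, Finset.sum_add_distrib, Finset.sum_const, smul_eq_mul] at h
  linarith

/-! ### The cube of plane graphs with a given restriction -/

/-- The graph obtained from `H` by joining `v` to the vertices in `A`. -/
def addStar (H : SimpleGraph S) (v : S) (A : Finset S) : SimpleGraph S where
  Adj a b := H.Adj a b ∨ a ≠ b ∧ (a = v ∧ b ∈ A ∨ b = v ∧ a ∈ A)
  symm := ⟨fun _ _ h => h.imp (fun h => h.symm) fun h => ⟨h.1.symm, h.2.symm⟩⟩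
  loopless := ⟨fun a h => h.elim (H.loopless.irrefl a) fun h => h.1 rfl⟩

/-- The vertices that `v` can be joined to without destroying the planarity of `H`. -/
noncomputable def visible (H : SimpleGraph S) (v : S) : Finset S :=
  Finset.univ.filter fun u => u ≠ v ∧ IsPlaneGraph S (addStar H v {u})

/-- Edges from a vertex `v` that can be added separately can be added jointly. -/
theorem isPlaneGraph_addStar (hH : IsPlaneGraph S H) {v : S} {A : Finset S}
    (hA : A ⊆ visible H v) : IsPlaneGraph S (addStar H v A) := by
  have hvis : ∀ u ∈ A, u ≠ v ∧ IsPlaneGraph S (addStar H v {u}) := fun u hu => by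
    simpa [visible] using hA hu
  -- every edge is an edge of `H` or, up to orientation, an edge `v u`
  have hadj : ∀ a b, (addStar H v A).Adj a b → H.Adj a b ∨ ∃ u ∈ A, s(a, b) = s(v, u) := by
    rintro a b (h | ⟨_, ⟨rfl, h⟩ | ⟨rfl, h⟩⟩)
    · exact Or.inl h
    · exact Or.inr ⟨b, h, rfl⟩
    · exact Or.inr ⟨a, h, Sym2.eq_swap⟩
  have hstar : ∀ u ∈ A, ∀ a b, s(a, b) = s(v, u) → (addStar H v {u}).Adj a b := by
    intro u hu a b h
    have hne := (hvis u hu).1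
    rcases Sym2.eq_iff.1 h with ⟨rfl, rfl⟩ | ⟨rfl, rfl⟩
    · exact Or.inr ⟨hne.symm, Or.inl ⟨rfl, by simp⟩⟩
    · exact Or.inr ⟨hne, Or.inr ⟨rfl, by simp⟩⟩
  refine ⟨fun p q r hpq hr => ?_, fun p q r s hpq hrs hne x hx hx' => ?_⟩
  · rcases hadj _ _ hpq with h | ⟨u, hu, h⟩
    · exact hH.vertex_edge _ _ _ h hr
    · exact (hvis u hu).2.vertex_edge _ _ _ (hstar u hu _ _ h) hr
  rcases hadj _ _ hpq with h | ⟨u, hu, h⟩ <;> rcases hadj _ _ hrs with h' | ⟨u', hu', h'⟩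
  · exact hH.edge_edge _ _ _ _ h h' hne x hx hx'
  · exact (hvis u' hu').2.edge_edge _ _ _ _ (Or.inl h) (hstar u' hu' _ _ h') hne x hx hx'
  · exact (hvis u hu).2.edge_edge _ _ _ _ (hstar u hu _ _ h) (Or.inl h') hne x hx hx'
  · have hseg : ∀ {a b u : S}, s(a, b) = s(v, u) →
        segment ℝ (a : Plane) b = segment ℝ (v : Plane) u := by
      intro a b u h
      rcases Sym2.eq_iff.1 h with ⟨rfl, rfl⟩ | ⟨rfl, rfl⟩
      · rfl
      · exact segment_symm _ _ _
    have huu : u ≠ u' := by rintro rfl; exact hne (h.trans h'.symm)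
    have hxv : x = v := by
      by_contra hxv
      rw [hseg h] at hx
      rw [hseg h'] at hx'
      rcases mem_segment_or_mem_segment_of_common hx hx' hxv with hm | hm
      · rcases (hvis u' hu').2.vertex_edge _ _ _ (hstar u' hu' _ _ rfl) hm with e | e
        · exact (hvis u hu).1 e
        · exact huu e
      · rcases (hvis u hu).2.vertex_edge _ _ _ (hstar u hu _ _ rfl) hm with e | e
        · exact (hvis u' hu').1 e
        · exact huu e.symm
    have hend : ∀ {a b u : S}, s(a, b) = s(v, u) → (v : Plane) = a ∨ (v : Plane) = b := by
      intro a b u h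
      rcases Sym2.eq_iff.1 h with ⟨rfl, _⟩ | ⟨_, rfl⟩
      · exact Or.inl rfl
      · exact Or.inr rfl
    rw [hxv]
    exact ⟨hend h, hend h'⟩

/-- The chord bound `2 ^ (10 - m) ≥ 11 - m`, in the form that it takes when summed over the subsets
of an `m`-element set, whose average size is `m / 2`. -/
theorem sum_powerset_le {α : Type*} (V : Finset α) :
    ∑ A ∈ V.powerset, (11 - 2 * (A.card : ℤ)) ≤ 1024 := by
  have hcompl : ∑ A ∈ V.powerset, (A.card : ℤ) = ∑ A ∈ V.powerset, ((V.card : ℤ) - A.card) := by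
    refine Finset.sum_nbij' (fun A => V \ A) (fun A => V \ A) ?_ ?_ ?_ ?_ ?_
    · simp
    · simp
    · intro A hA
      exact Finset.sdiff_sdiff_eq_self (Finset.mem_powerset.1 hA)
    · intro A hA
      exact Finset.sdiff_sdiff_eq_self (Finset.mem_powerset.1 hA)
    · intro A hA
      rw [Finset.card_sdiff_of_subset (Finset.mem_powerset.1 hA),
        Nat.cast_sub (Finset.card_le_card (Finset.mem_powerset.1 hA))]
      ring
  rw [Finset.sum_sub_distrib, Finset.sum_const, Finset.card_powerset, nsmul_eq_mul] at hcompl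
  rw [Finset.sum_sub_distrib, ← Finset.mul_sum, Finset.sum_const, Finset.card_powerset,
    nsmul_eq_mul]
  push_cast at hcompl ⊢
  have h : (2 : ℤ) ^ V.card * (11 - V.card) ≤ 1024 := by
    rcases le_or_gt V.card 10 with hc | hc
    · -- only finitely many sizes give a positive left-hand side
      generalize V.card = m at hc ⊢
      interval_cases m <;> norm_num
    · have : (11 : ℤ) - V.card ≤ 0 := by
        have : (11 : ℤ) ≤ V.card := by exact_mod_cast hc
        linarith
      exact (mul_nonpos_of_nonneg_of_nonpos (by positivity) this).trans (by norm_num)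
  linarith

/-- The plane graphs that restrict to `H` away from `v` form a cube: the neighbourhood of `v` is an
arbitrary set of visible vertices. -/
theorem sum_fiber_le (hH : IsPlaneGraph S H) {v : S} (hv : nbrs H v = ∅) :
    ∑ G ∈ (planeFinset S).filter (fun G => G.deleteIncidenceSet v = H),
      (11 - 2 * ((nbrs G v).card : ℤ)) ≤ 1024 := by
  have hHv : ∀ u, ¬ H.Adj v u := fun u h => by
    have := mem_nbrs.2 h
    simp [hv] at this
  have hvis : ∀ u ∈ visible H v, u ≠ v := fun u hu => by
    simp only [visible, Finset.mem_filter] at hu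
    exact hu.2.1
  refine le_of_eq_of_le ?_ (sum_powerset_le (visible H v))
  refine Finset.sum_nbij' (fun G => nbrs G v) (fun A => addStar H v A) ?_ ?_ ?_ ?_ (fun _ _ => rfl)
  · intro G hG
    obtain ⟨hG', rfl⟩ := Finset.mem_filter.1 hG
    rw [mem_planeFinset] at hG'
    refine Finset.mem_powerset.2 fun u hu => ?_
    rw [mem_nbrs] at hu
    simp only [visible, Finset.mem_filter, Finset.mem_univ, true_and]
    refine ⟨hu.ne', hG'.mono ?_⟩
    rintro a b (h | ⟨_, ⟨rfl, h⟩ | ⟨rfl, h⟩⟩)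
    · exact G.deleteIncidenceSet_le v h
    · rwa [Finset.mem_singleton.1 h]
    · rw [Finset.mem_singleton.1 h]
      exact hu.symm
  · intro A hA
    rw [Finset.mem_powerset] at hA
    refine Finset.mem_filter.2 ⟨mem_planeFinset.2 (isPlaneGraph_addStar hH hA), ?_⟩
    ext a b
    rw [SimpleGraph.deleteIncidenceSet_adj]
    constructor
    · rintro ⟨h | ⟨_, h | h⟩, ha, hb⟩
      · exact h
      · exact absurd h.1 ha
      · exact absurd h.1 hb
    · refine fun h => ⟨Or.inl h, ?_, ?_⟩
      · rintro rfl
        exact hHv _ h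
      · rintro rfl
        exact hHv _ h.symm
  · intro G hG
    obtain ⟨-, rfl⟩ := Finset.mem_filter.1 hG
    ext a b
    constructor
    · rintro (h | ⟨_, ⟨rfl, h⟩ | ⟨rfl, h⟩⟩)
      · exact G.deleteIncidenceSet_le v h
      · exact mem_nbrs.1 h
      · exact (mem_nbrs.1 h).symm
    · intro h
      by_cases ha : a = v
      · subst ha
        exact Or.inr ⟨h.ne, Or.inl ⟨rfl, mem_nbrs.2 h⟩⟩
      by_cases hb : b = v
      · subst hb
        exact Or.inr ⟨h.ne, Or.inr ⟨rfl, mem_nbrs.2 h.symm⟩⟩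
      exact Or.inl (SimpleGraph.deleteIncidenceSet_adj.2 ⟨h, ha, hb⟩)
  · intro A hA
    ext u
    rw [mem_nbrs]
    constructor
    · rintro (h | ⟨hne, ⟨_, h⟩ | ⟨h, _⟩⟩)
      · exact absurd h (hHv u)
      · exact h
      · exact absurd h.symm hne
    · intro h
      exact Or.inr ⟨(hvis u (Finset.mem_powerset.1 hA h)).symm, Or.inl ⟨rfl, h⟩⟩

/-! ### Induction on the number of points -/

/-- A graph in which `v` is isolated is determined by its restriction to the other points. -/
theorem card_isolated_le (v : S) :
    ((planeFinset S).filter fun G => nbrs G v = ∅).card ≤ pg (S.erase v) := by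
  rw [pg_eq_card_planeFinset]
  let ι : ↥(S.erase (v : Plane)) → S := fun p => ⟨p, Finset.mem_of_mem_erase p.2⟩
  have hι : Function.Injective ι := fun p q h => Subtype.ext (congrArg (fun z : S => (z : Plane)) h)
  have hsurj : ∀ p : S, p ≠ v → ∃ q, ι q = p := fun p hp =>
    ⟨⟨p, Finset.mem_erase.2 ⟨fun h => hp (Subtype.ext h), p.2⟩⟩, rfl⟩
  refine Finset.card_le_card_of_injOn (fun G => G.comap ι) ?_ ?_
  · intro G hG
    have hG := mem_planeFinset.1 (Finset.mem_filter.1 hG).1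
    refine mem_planeFinset.2 ⟨fun p q r hpq hr => ?_, fun p q r s hpq hrs hne x hx hx' => ?_⟩
    · exact (hG.vertex_edge (ι p) (ι q) (ι r) hpq hr).imp (fun h => hι h) fun h => hι h
    · refine hG.edge_edge (ι p) (ι q) (ι r) (ι s) hpq hrs (fun h => hne ?_) x hx hx'
      exact Sym2.map.injective hι h
  · intro G₁ h₁ G₂ h₂ (h : G₁.comap ι = G₂.comap ι)
    have iso : ∀ {G : SimpleGraph S}, nbrs G v = ∅ → ∀ u, ¬ G.Adj v u := fun hv u hu => by
      have := mem_nbrs.2 hu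
      simp [hv] at this
    have i₁ := iso (Finset.mem_filter.1 (Finset.mem_coe.1 h₁)).2
    have i₂ := iso (Finset.mem_filter.1 (Finset.mem_coe.1 h₂)).2
    ext a b
    by_cases ha : a = v
    · subst ha
      exact iff_of_false (i₁ b) (i₂ b)
    by_cases hb : b = v
    · subst hb
      exact iff_of_false (fun h => i₁ a h.symm) (fun h => i₂ a h.symm)
    obtain ⟨a, rfl⟩ := hsurj a ha
    obtain ⟨b, rfl⟩ := hsurj b hb
    exact iff_of_eq (congrArg (fun K => K.Adj a b) h)

/-- For each vertex `v`, summing the cube estimate bounds the number of plane graphs in which `v` is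
isolated from below in terms of the total degree of `v`; the edge count controls the sum of these
degrees over all `v`. -/
theorem card_mul_pg_le (S : Finset Plane) :
    S.card * pg S ≤ 1024 * ∑ v : S, pg (S.erase v) := by
  have hv : ∀ v : S, 11 * (pg S : ℤ) - 2 * ∑ G ∈ planeFinset S, ((nbrs G v).card : ℤ)
      ≤ 1024 * pg (S.erase v) := by
    intro v
    set I := (planeFinset S).filter fun G => nbrs G v = ∅
    have hmaps : ∀ G ∈ planeFinset S, G.deleteIncidenceSet v ∈ I := by
      intro G hG
      refine Finset.mem_filter.2 ⟨mem_planeFinset.2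
        ((mem_planeFinset.1 hG).mono (G.deleteIncidenceSet_le v)), ?_⟩
      ext u
      simp [mem_nbrs, SimpleGraph.deleteIncidenceSet_adj]
    calc 11 * (pg S : ℤ) - 2 * ∑ G ∈ planeFinset S, ((nbrs G v).card : ℤ)
        = ∑ G ∈ planeFinset S, (11 - 2 * ((nbrs G v).card : ℤ)) := by
          rw [Finset.sum_sub_distrib, Finset.mul_sum, Finset.sum_const, nsmul_eq_mul,
            pg_eq_card_planeFinset]
          ring
      _ = ∑ H ∈ I, ∑ G ∈ (planeFinset S).filter (fun G => G.deleteIncidenceSet v = H),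
            (11 - 2 * ((nbrs G v).card : ℤ)) := (Finset.sum_fiberwise_of_maps_to hmaps _).symm
      _ ≤ ∑ H ∈ I, 1024 := Finset.sum_le_sum fun H hH =>
          sum_fiber_le (mem_planeFinset.1 (Finset.mem_filter.1 hH).1) (Finset.mem_filter.1 hH).2
      _ = 1024 * (I.card : ℤ) := by rw [Finset.sum_const, nsmul_eq_mul, mul_comm]
      _ ≤ 1024 * pg (S.erase v) := by
          have : (I.card : ℤ) ≤ pg (S.erase v) := by exact_mod_cast card_isolated_le v
          linarith
  have hsum := Finset.sum_le_sum fun v (_ : v ∈ (Finset.univ : Finset S)) => hv v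
  rw [Finset.sum_sub_distrib, ← Finset.mul_sum, ← Finset.mul_sum, Finset.sum_comm,
    Finset.sum_const, Finset.card_univ, Fintype.card_coe, nsmul_eq_mul,
    ← Finset.mul_sum] at hsum
  have hdeg : ∑ G ∈ planeFinset S, ∑ v, ((nbrs G v).card : ℤ) ≤ 5 * S.card * pg S := by
    rw [pg_eq_card_planeFinset]
    exact_mod_cast sum_sum_card_nbrs_le S
  have : (S.card : ℤ) * pg S ≤ 1024 * ∑ v : S, (pg (S.erase v) : ℤ) := by linarith
  exact_mod_cast this

theorem pg_le (N : ℕ) (S : Finset Plane) (hS : S.card = N) : pg S ≤ 1024 ^ N := by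
  induction N generalizing S with
  | zero =>
    have : IsEmpty S := by rw [Finset.card_eq_zero.1 hS]; infer_instance
    rw [pg_eq_card_planeFinset]
    exact (Finset.card_le_univ _).trans (Fintype.card_le_one_iff_subsingleton.2 inferInstance)
  | succ n ih =>
    have h := card_mul_pg_le S
    have h' : ∑ v : S, pg (S.erase v) ≤ (n + 1) * 1024 ^ n := by
      refine (Finset.sum_le_card_nsmul _ _ (1024 ^ n) fun v _ => ?_).trans (by simp [hS])
      exact ih _ (by rw [Finset.card_erase_of_mem v.2, hS, Nat.add_sub_cancel])
    rw [hS] at h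
    have : (n + 1) * pg S ≤ (n + 1) * 1024 ^ (n + 1) := by
      calc (n + 1) * pg S ≤ 1024 * ((n + 1) * 1024 ^ n) := h.trans (Nat.mul_le_mul_left _ h')
        _ = (n + 1) * 1024 ^ (n + 1) := by ring
    exact Nat.le_of_mul_le_mul_left this n.succ_pos

end

theorem mainTheorem2 (N : ℕ) (S : Finset Plane) (hS : S.card = N) :
    (pg S : ℝ) ≤ (3207.42 : ℝ) ^ N := by
  calc (pg S : ℝ) ≤ (1024 : ℝ) ^ N := by exact_mod_cast pg_le N S hS
    _ ≤ (3207.42 : ℝ) ^ N := pow_le_pow_left₀ (by norm_num) (by norm_num) N
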